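/- **Fundamental Lemma of Classical Mechanics.** Let $M$ be a finite-dimensional smooth manifold with a non-degenerate metric $T_2$ of arbitrary signature, i.e. a smooth symmetric 2-covariant tensor field such that $T_2(v,\cdot)\neq 0$ for every tangent vector $v\ne 0$. Let $\pi\colon TM\to M$ be the tangent bundle. A *second order differential equation* on $M$ is a smooth vector field $D$ on $TM$ with $\pi_*(D_v)=v$ for all $v\in TM$. A *horizontal 1-form* is a smooth 1-form $\alpha$ on $TM$ that vanishes on all vertical vectors, i.e. on all $V\in T(TM)$ with $\pi_*V=0$. Let $\theta$ be the Liouville form of $T^*M$ transported to $TM$ by the isomorphism $TM\simeq T^*M$ that $T_2$ defines, that is, $\theta_v(Y)=T_2(v,\pi_*Y)$ for $v\in TM$ and $Y\in T_v(TM)$; let $\omega_2=d\theta$ be the corresponding symplectic form on $TM$, and let $T(v)=\tfrac12T_2(v,v)$ be the kinetic energy. 1. The equation $$D\,\lrcorner\,\omega_2+dT+\alpha=0 \tag{1}$$ establishes a one-to-one correspondence between second order differential equations $D$ on $M$ and horizontal 1-forms $\alpha$ on $TM$: for each second order differential equation $D$ there is exactly one horizontal 1-form $\alpha$ satisfying (1),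 and for each horizontal 1-form $\alpha$ there is exactly one second order differential equation $D$ satisfying (1). 2. Let $D$ and $\alpha$ correspond to each other by (1). A smooth vector field $u$ on $M$ is an *intermediate integral* of $D$ if, regarding $u$ as a section $u\colon M\to TM$, the field $D$ is tangent to $u(M)$, i.e. $D_{u(x)}\in u_*(T_xM)$ for all $x\in M$. This holds if and only if $$u\,\lrcorner\, d(u\,\lrcorner\, T_2)+d(T(u))+u^*\alpha=0,$$ where $T(u)=T\circ u$ and $u^*\alpha$ is the pull-back of $\alpha$ by the section $u\colon M\to TM$. -/

import Mathlib

open Set Bundle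
open scoped Manifold ContDiff Topology

namespace ClassicalMechanics

noncomputable section

/-! ### Vector fields and differential forms on a manifold -/

section Forms

variable {E : Type*} [NormedAddCommGroup E] [NormedSpace ℝ E]
  {H : Type*} [TopologicalSpace H] (I : ModelWithCorners ℝ E H)
  {N : Type*} [TopologicalSpace N] [ChartedSpace H N]

/-- A vector field `X` on the manifold `N` is smooth, as a section of the tangent bundle. -/
def SmoothVectorField [IsManifold I 1 N] (X : Π p : N, TangentSpace I p) : Prop :=
  ContMDiff I I.tangent ∞ (fun p : N => (⟨p, X p⟩ : TangentBundle I N))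

/-- A 1-form `α` on the manifold `N` is smooth, as a section of the cotangent bundle. -/
def SmoothOneForm [IsManifold I 1 N] (α : Π p : N, TangentSpace I p →L[ℝ] ℝ) : Prop :=
  ContMDiff I (I.prod 𝓘(ℝ, E →L[ℝ] ℝ)) ∞
    (fun p : N => TotalSpace.mk' (E →L[ℝ] ℝ)
      (E := fun p : N => TangentSpace I p →L[ℝ] Bundle.Trivial N ℝ p) p (α p))

/-- The expression of the 1-form `α` in the preferred chart at `p`, that is, the pullback of `α`
under the inverse of the chart; it is a 1-form on the model vector space `E`. -/
def oneFormInChart (α : Π q : N, TangentSpace I q →L[ℝ] ℝ) (p : N) (y : E) : E →L[ℝ] ℝ :=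
  (α ((extChartAt I p).symm y)).comp
    (mfderivWithin 𝓘(ℝ, E) I (extChartAt I p).symm (range I) y)

/-- The exterior derivative `dα` of a 1-form `α` on a manifold: at the point `p`, it is the
pullback under the preferred chart at `p` of the exterior derivative of the expression of `α` in
that chart. The convention is `dα(X, Y) = X(α(Y)) - Y(α(X)) - α([X, Y])`. -/
def extDerivOneForm (α : Π q : N, TangentSpace I q →L[ℝ] ℝ) (p : N) :
    (TangentSpace I p) [⋀^Fin 2]→L[ℝ] ℝ :=
  (extDerivWithin
      (fun y : E => ContinuousAlternatingMap.ofSubsingleton ℝ E ℝ (0 : Fin 1)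
        (oneFormInChart I α p y))
      (range I) (extChartAt I p p)).compContinuousLinearMap
    (mfderiv I 𝓘(ℝ, E) (extChartAt I p) p)

/-- The differential `df` of a function `f : N → ℝ`. -/
def differential (f : N → ℝ) (p : N) : TangentSpace I p →L[ℝ] ℝ :=
  mfderiv I 𝓘(ℝ, ℝ) f p

/-- A non-degenerate metric `T₂` of arbitrary signature on `N`: a smooth symmetric 2-covariant
tensor field without kernel. -/
structure NondegenerateMetric (N : Type*) [TopologicalSpace N] [ChartedSpace H N]
    [IsManifold I 1 N] where
  /-- the bilinear form on each tangent space -/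
  toFun (x : N) : TangentSpace I x →L[ℝ] TangentSpace I x →L[ℝ] ℝ
  symm (x : N) (v w : TangentSpace I x) : toFun x v w = toFun x w v
  nondegenerate (x : N) (v : TangentSpace I x) (hv : ∀ w, toFun x v w = 0) : v = 0
  contMDiff : ContMDiff I (I.prod 𝓘(ℝ, E →L[ℝ] E →L[ℝ] ℝ)) ∞
    (fun x : N => TotalSpace.mk' (E →L[ℝ] E →L[ℝ] ℝ)
      (E := fun x : N => TangentSpace I x →L[ℝ] TangentSpace I x →L[ℝ] Bundle.Trivial N ℝ x)
      x (toFun x))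

end Forms

/-! ### The geometry of the tangent bundle -/

section Tangent

variable {E : Type*} [NormedAddCommGroup E] [NormedSpace ℝ E]
  {H : Type*} [TopologicalSpace H] (I : ModelWithCorners ℝ E H)
  {M : Type*} [TopologicalSpace M] [ChartedSpace H M] [IsManifold I 1 M]

/-- The tangent map `π_* : T_v(TM) → T_{π(v)} M` of the canonical projection `π : TM → M`. -/
def projTangentMap (v : TangentBundle I M) :
    TangentSpace I.tangent v →L[ℝ] TangentSpace I v.proj :=
  mfderiv I.tangent I (fun w : TangentBundle I M => w.proj) v

/-- A smooth 1-form on `TM` is horizontal if it annihilates the vertical tangent vectors, those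
tangent to the fibres of `π : TM → M`. -/
def IsHorizontalForm [IsManifold I.tangent 1 (TangentBundle I M)]
    (α : Π v : TangentBundle I M, TangentSpace I.tangent v →L[ℝ] ℝ) : Prop :=
  SmoothOneForm I.tangent α ∧
    ∀ (v : TangentBundle I M) (V : TangentSpace I.tangent v),
      projTangentMap I v V = 0 → α v V = 0

/-- A second order differential equation on `M`: a smooth vector field `D` on `TM` whose value at
each `v` is an acceleration, `π_* (D v) = v`. -/
def IsSecondOrderEquation [IsManifold I.tangent 1 (TangentBundle I M)]
    (D : Π v : TangentBundle I M, TangentSpace I.tangent v) : Prop :=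
  SmoothVectorField I.tangent D ∧
    ∀ v : TangentBundle I M, projTangentMap I v (D v) = v.snd

/-- The vector field `u` seen as a section `M → TM`. -/
def fieldSection (u : Π x : M, TangentSpace I x) (x : M) : TangentBundle I M := ⟨x, u x⟩

/-- The tangent map `u_* : T_x M → T_{u(x)}(TM)` of the section `u : M → TM`. -/
def fieldTangentMap (u : Π x : M, TangentSpace I x) (x : M) :
    TangentSpace I x →L[ℝ] TangentSpace I.tangent (fieldSection I u x) :=
  mfderiv I I.tangent (fieldSection I u) x

/-- The smooth vector field `u` on `M` is an intermediate integral of the vector field `D` on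
`TM`: `D` is tangent to the submanifold `u(M)` of `TM` at each point of it. -/
def IsIntermediateIntegral
    (D : Π v : TangentBundle I M, TangentSpace I.tangent v) (u : Π x : M, TangentSpace I x) :
    Prop :=
  ∀ x : M, D (fieldSection I u x) ∈ range (fieldTangentMap I u x)

variable {I}

/-- The Liouville form of `T*M` transported to `TM` by the metric:
`θ_v = v ⌟ T₂`, pulled back from `M` to `TM`. -/
def NondegenerateMetric.liouvilleForm (g : NondegenerateMetric I M) (v : TangentBundle I M) :
    TangentSpace I.tangent v →L[ℝ] ℝ :=
  (g.toFun v.proj v.snd).comp (projTangentMap I v)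

/-- The symplectic form `ω₂ = dθ` on `TM`. -/
def NondegenerateMetric.symplecticForm (g : NondegenerateMetric I M) (v : TangentBundle I M) :
    (TangentSpace I.tangent v) [⋀^Fin 2]→L[ℝ] ℝ :=
  extDerivOneForm I.tangent g.liouvilleForm v

/-- The kinetic energy `T(v) = T₂(v, v) / 2`. -/
def NondegenerateMetric.kineticEnergy (g : NondegenerateMetric I M) (v : TangentBundle I M) : ℝ :=
  (1 / 2) * g.toFun v.proj v.snd v.snd

/-- The Newton equation `D ⌟ ω₂ + dT + α = 0`, an equality of 1-forms on `TM`. -/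
def NewtonEquation (g : NondegenerateMetric I M)
    (D : Π v : TangentBundle I M, TangentSpace I.tangent v)
    (α : Π v : TangentBundle I M, TangentSpace I.tangent v →L[ℝ] ℝ) : Prop :=
  ∀ (v : TangentBundle I M) (Y : TangentSpace I.tangent v),
    g.symplecticForm v ![D v, Y]
      + differential I.tangent g.kineticEnergy v Y + α v Y = 0

/-- The equation `u ⌟ d(u ⌟ T₂) + d(T(u)) + u^* α = 0`, an equality of 1-forms on `M`. -/
def IntermediateNewtonEquation (g : NondegenerateMetric I M)
    (α : Π v : TangentBundle I M, TangentSpace I.tangent v →L[ℝ] ℝ)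
    (u : Π x : M, TangentSpace I x) : Prop :=
  ∀ (x : M) (Y : TangentSpace I x),
    extDerivOneForm I (fun x' : M => g.toFun x' (u x')) x ![u x, Y]
      + differential I (fun x' : M => g.kineticEnergy (fieldSection I u x')) x Y
      + α (fieldSection I u x) (fieldTangentMap I u x Y) = 0

end Tangent

end

end ClassicalMechanics

/-! In a chart of `M` with coordinate y, let G be the expression of the metric and (y, w) the
induced chart of `TM`. Then θ = G(w, dy) and T = G(w, w)/2. If D = (w, b) is an acceleration, the
fibre component of dT cancels against that of D ⌟ ω₂, and what remains, D ⌟ ω₂ + dT, is the form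
G(b) + Γ in dy alone, where Γ(c) = (∂_w G)(w, c) - (∂_c G)(w, w)/2
(`symplecticForm_add_differential`, `newton_lhs_eq`). Since a horizontal α is also a form in dy
alone, the Newton equation becomes G(b) + Γ + α = 0. It determines α from b, and b from α because G
is invertible (`newton_iff_acceleration`). Smoothness of either one can be read off this formula,
valid throughout each chart.

For the second part, write the section as y ↦ (y, f(y)). Its tangent vectors are (a, Df(a)), so D is
tangent to it exactly when Df(f) = b. The same cancellation turns u ⌟ d(u ⌟ T₂) + d(T(u)) into
G(Df(f)) + Γ (`intermediate_lhs_eq`), while u^*α = -(G(b) + Γ). The equation thus says G(Df(f) - b)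
= 0, and non-degeneracy concludes.

The exterior derivative is defined with a different chart at each point;
`extDerivOneForm_apply_eq_chart` allows one fixed chart to be used near a point. -/

namespace ClassicalMechanics

noncomputable section

/-! ### Chart expressions and chart independence of the exterior derivative. -/

section Charts

variable {E : Type*} [NormedAddCommGroup E] [NormedSpace ℝ E]
  {H : Type*} [TopologicalSpace H] (I : ModelWithCorners ℝ E H)
  {N : Type*} [TopologicalSpace N] [ChartedSpace H N]
  {F : Type*} [NormedAddCommGroup F] [NormedSpace ℝ F]

/-- The tangent map of the preferred chart at `p`, at the point `q`. -/
def chartDeriv (p q : N) : TangentSpace I q →L[ℝ] E :=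
  mfderiv I 𝓘(ℝ, E) (extChartAt I p) q

/-- The tangent map of the inverse of the preferred chart at `p`, at the point `y`. -/
def chartDerivSymm (p : N) (y : E) : E →L[ℝ] TangentSpace I ((extChartAt I p).symm y) :=
  mfderivWithin 𝓘(ℝ, E) I (extChartAt I p).symm (range I) y

/-- The expression of the vector field `X` in the preferred chart at `p`. -/
def vectorFieldInChart (X : Π q : N, TangentSpace I q) (p : N) (y : E) : E :=
  chartDeriv I p ((extChartAt I p).symm y) (X ((extChartAt I p).symm y))

variable {I}

theorem oneFormInChart_apply (α : Π q : N, TangentSpace I q →L[ℝ] ℝ) (p : N) (y a : E) :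
    oneFormInChart I α p y a = α ((extChartAt I p).symm y) (chartDerivSymm I p y a) := rfl

theorem chartDeriv_chartDerivSymm [IsManifold I 1 N] {p : N} {y : E}
    (hy : y ∈ (extChartAt I p).target) (a : E) :
    chartDeriv I p ((extChartAt I p).symm y) (chartDerivSymm I p y a) = a :=
  DFunLike.congr_fun (mfderiv_extChartAt_comp_mfderivWithin_extChartAt_symm hy) a

theorem chartDerivSymm_chartDeriv [IsManifold I 1 N] {p : N} {y : E}
    (hy : y ∈ (extChartAt I p).target) (X : TangentSpace I ((extChartAt I p).symm y)) :
    chartDerivSymm I p y (chartDeriv I p ((extChartAt I p).symm y) X) = X :=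
  DFunLike.congr_fun (mfderivWithin_extChartAt_symm_comp_mfderiv_extChartAt hy) X

theorem chartDeriv_injective [IsManifold I 1 N] {p : N} {y : E}
    (hy : y ∈ (extChartAt I p).target) :
    Function.Injective (chartDeriv I p ((extChartAt I p).symm y)) :=
  Function.LeftInverse.injective (chartDerivSymm_chartDeriv hy)

theorem exists_chart_point {p q : N} (hq : q ∈ (chartAt H p).source) :
    ∃ y ∈ (extChartAt I p).target, (extChartAt I p).symm y = q := by
  rw [← extChartAt_source I] at hq
  exact ⟨_, (extChartAt I p).map_source hq, (extChartAt I p).left_inv hq⟩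

theorem mdifferentiableAt_chart [IsManifold I 1 N] {p : N} {y : E}
    (hy : y ∈ (extChartAt I p).target) :
    MDifferentiableAt I 𝓘(ℝ, E) (extChartAt I p) ((extChartAt I p).symm y) :=
  mdifferentiableAt_extChartAt (by
    rw [← extChartAt_source I]; exact (extChartAt I p).map_target hy)

/-- The pullback of a 1-form under a map from a vector space. -/
def pullbackForm (α : Π q : N, TangentSpace I q →L[ℝ] ℝ) (f : E → N) (y : E) : E →L[ℝ] ℝ :=
  (α (f y)).comp (mfderiv 𝓘(ℝ, E) I f y)

theorem pullbackForm_congr (α : Π q : N, TangentSpace I q →L[ℝ] ℝ) {f g : E → N} {y : E}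
    (h : f =ᶠ[𝓝 y] g) : pullbackForm α f y = pullbackForm α g y := by
  -- The covectors at `f y` and `g y` have different types; since every tangent space unfolds to
  -- `E`, they can be compared as functionals on `E`.
  have key : ∀ (x x' : N) (_ : x = x') (T : E →L[ℝ] E),
      ContinuousLinearMap.comp (α x : E →L[ℝ] ℝ) T =
        ContinuousLinearMap.comp (α x' : E →L[ℝ] ℝ) T := by
    rintro x x' rfl T; rfl
  have hT : (mfderiv 𝓘(ℝ, E) I f y : E →L[ℝ] E) = mfderiv 𝓘(ℝ, E) I g y := h.mfderiv_eq
  have := key _ _ h.self_of_nhds (mfderiv 𝓘(ℝ, E) I f y)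
  refine this.trans ?_
  exact congrArg (ContinuousLinearMap.comp (α (g y) : E →L[ℝ] ℝ)) hT

theorem pullbackForm_comp (α : Π q : N, TangentSpace I q →L[ℝ] ℝ) {f : E → N} {τ : E → E} {y : E}
    (hf : MDifferentiableAt 𝓘(ℝ, E) I f (τ y)) (hτ : DifferentiableAt ℝ τ y) :
    pullbackForm α (f ∘ τ) y = (pullbackForm α f (τ y)).comp (fderiv ℝ τ y) := by
  rw [pullbackForm, mfderiv_comp y hf hτ.mdifferentiableAt, mfderiv_eq_fderiv]
  rfl

/-- The tangent map of a function with values in a vector space, computed in a chart. -/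
theorem mfderiv_apply_eq_chart [IsManifold I 1 N] {f : N → F} {p : N} {y : E}
    (hy : y ∈ (extChartAt I p).target)
    (hf : DifferentiableAt ℝ (f ∘ (extChartAt I p).symm) y)
    (X : TangentSpace I ((extChartAt I p).symm y)) :
    mfderiv I 𝓘(ℝ, F) f ((extChartAt I p).symm y) X =
      fderiv ℝ (f ∘ (extChartAt I p).symm) y (chartDeriv I p ((extChartAt I p).symm y) X) := by
  set φ := extChartAt I p
  have hsrc : φ.source ∈ 𝓝 (φ.symm y) :=
    (isOpen_extChartAt_source p).mem_nhds (φ.map_target hy)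
  have he : f =ᶠ[𝓝 (φ.symm y)] (f ∘ φ.symm) ∘ φ := by
    filter_upwards [hsrc] with q hq
    simp [φ.left_inv hq]
  have hr : φ (φ.symm y) = y := φ.right_inv hy
  have h1 : MDifferentiableAt 𝓘(ℝ, E) 𝓘(ℝ, F) (f ∘ φ.symm) (φ (φ.symm y)) := by
    rw [hr]; exact hf.mdifferentiableAt
  rw [he.mfderiv_eq, mfderiv_comp _ h1 (mdifferentiableAt_chart hy), mfderiv_eq_fderiv, hr]
  rfl

theorem differentiableAt_ofSubsingleton {β : E → E →L[ℝ] ℝ} {y : E}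
    (hβ : DifferentiableAt ℝ β y) :
    DifferentiableAt ℝ
      (fun z => ContinuousAlternatingMap.ofSubsingleton ℝ E ℝ (0 : Fin 1) (β z)) y :=
  (ContinuousAlternatingMap.ofSubsingletonLIE (𝕜 := ℝ) (E := E) (F := ℝ)
    (0 : Fin 1)).differentiable.differentiableAt.comp y hβ

theorem extDeriv_ofSubsingleton_apply {β : E → E →L[ℝ] ℝ} {y : E} (hβ : DifferentiableAt ℝ β y)
    (a b : E) :
    extDeriv (fun z => ContinuousAlternatingMap.ofSubsingleton ℝ E ℝ (0 : Fin 1) (β z)) y ![a, b] =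
      fderiv ℝ β y a b - fderiv ℝ β y b a := by
  have h1 : ∀ c : E, fderiv ℝ (fun z => β z c) y = (fderiv ℝ β y).flip c := by
    intro c
    ext d
    simp [fderiv_clm_apply hβ (differentiableAt_const c)]
  rw [extDeriv_apply (differentiableAt_ofSubsingleton hβ)]
  simp [Fin.sum_univ_two, Fin.removeNth, h1]
  ring

variable [I.Boundaryless]

theorem contMDiffAt_iff_contDiffAt_chart {n : WithTop ℕ∞} {f : N → F} {p : N} :
    ContMDiffAt I 𝓘(ℝ, F) n f p ↔
      ContDiffAt ℝ n (f ∘ (extChartAt I p).symm) (extChartAt I p p) := by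
  rw [contMDiffAt_iff_source, I.range_eq_univ, contMDiffWithinAt_univ, contMDiffAt_iff_contDiffAt]

theorem eventually_chart_symm_mem_source (p : N) :
    ∀ᶠ y in 𝓝 (extChartAt I p p),
      y ∈ (extChartAt I p).target ∧ (extChartAt I p).symm y ∈ (chartAt H p).source := by
  filter_upwards [extChartAt_target_mem_nhds (I := I) p] with y hy
  exact ⟨hy, by rw [← extChartAt_source I]; exact (extChartAt I p).map_target hy⟩

theorem mdifferentiableAt_chart_symm [IsManifold I 1 N] {p : N} {y : E}
    (hy : y ∈ (extChartAt I p).target) :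
    MDifferentiableAt 𝓘(ℝ, E) I (extChartAt I p).symm y := by
  have := mdifferentiableWithinAt_extChartAt_symm hy
  rwa [I.range_eq_univ, mdifferentiableWithinAt_univ] at this

theorem chartDerivSymm_eq (p : N) (y : E) :
    chartDerivSymm I p y = mfderiv 𝓘(ℝ, E) I (extChartAt I p).symm y := by
  rw [chartDerivSymm, I.range_eq_univ, mfderivWithin_univ]

theorem oneFormInChart_eq_pullbackForm (α : Π q : N, TangentSpace I q →L[ℝ] ℝ) (p : N) :
    oneFormInChart I α p = pullbackForm α (extChartAt I p).symm := by
  ext y a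
  rw [oneFormInChart_apply, chartDerivSymm_eq]
  rfl


theorem extDerivOneForm_apply (α : Π q : N, TangentSpace I q →L[ℝ] ℝ) (p : N)
    (X Y : TangentSpace I p) :
    extDerivOneForm I α p ![X, Y] =
      extDeriv (fun y : E => ContinuousAlternatingMap.ofSubsingleton ℝ E ℝ (0 : Fin 1)
        (oneFormInChart I α p y)) (extChartAt I p p) ![chartDeriv I p p X, chartDeriv I p p Y] := by
  rw [← extDerivWithin_univ, ← I.range_eq_univ]
  refine congrArg (extDerivWithin (fun y : E => ContinuousAlternatingMap.ofSubsingleton ℝ E ℝ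
    (0 : Fin 1) (oneFormInChart I α p y)) (range I) (extChartAt I p p)) ?_
  funext i
  fin_cases i <;> rfl

/-- The exterior derivative of a 1-form, computed in an arbitrary chart. -/
theorem extDerivOneForm_apply_eq_chart [IsManifold I ∞ N]
    {α : Π q : N, TangentSpace I q →L[ℝ] ℝ} {p : N} {y : E}
    (hy : y ∈ (extChartAt I p).target)
    (hα : DifferentiableAt ℝ (oneFormInChart I α ((extChartAt I p).symm y))
      (extChartAt I ((extChartAt I p).symm y) ((extChartAt I p).symm y)))
    (hα' : DifferentiableAt ℝ (oneFormInChart I α p) y)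
    (X Y : TangentSpace I ((extChartAt I p).symm y)) :
    extDerivOneForm I α ((extChartAt I p).symm y) ![X, Y] =
      fderiv ℝ (oneFormInChart I α p) y (chartDeriv I p ((extChartAt I p).symm y) X)
          (chartDeriv I p ((extChartAt I p).symm y) Y) -
        fderiv ℝ (oneFormInChart I α p) y (chartDeriv I p ((extChartAt I p).symm y) Y)
          (chartDeriv I p ((extChartAt I p).symm y) X) := by
  set φ := extChartAt I p with hφ
  set q := φ.symm y with hq
  set ψ := extChartAt I q with hψ
  -- τ is the transition map from the fixed chart at `p` to the preferred chart at `q`, the one in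
  -- which the exterior derivative at `q` is defined.
  set τ : E → E := ψ ∘ φ.symm with hτ
  have hτd : ContDiffAt ℝ ∞ τ y := by
    rw [← contMDiffAt_iff_contDiffAt]
    have h1 : ContMDiffAt I 𝓘(ℝ, E) ∞ ψ q := contMDiffAt_extChartAt
    have h2 : ContMDiffAt 𝓘(ℝ, E) I ∞ φ.symm y := by
      have := contMDiffWithinAt_extChartAt_symm_range (I := I) (n := ∞) p hy
      rwa [I.range_eq_univ, contMDiffWithinAt_univ] at this
    exact h1.comp y h2
  have hτd' : DifferentiableAt ℝ τ y := hτd.differentiableAt (by simp)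
  have hcont : ContinuousAt φ.symm y := continuousAt_extChartAt_symm'' hy
  have hev : ∀ᶠ z in 𝓝 y, φ.symm z ∈ ψ.source :=
    hcont.eventually ((isOpen_extChartAt_source q).mem_nhds (mem_extChartAt_source q))
  -- Near y one has φ⁻¹ = ψ⁻¹ ∘ τ, so the expression of α in φ is the pullback under τ of its
  -- expression in ψ.
  have hform : ∀ᶠ z in 𝓝 y, oneFormInChart I α p z =
      (oneFormInChart I α q (τ z)).comp (fderiv ℝ τ z) := by
    have hd : ∀ᶠ z in 𝓝 y, DifferentiableAt ℝ τ z := by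
      filter_upwards [(hτd.of_le (m := 1) (by exact_mod_cast le_top)).eventually (by simp)]
        with z hz using hz.differentiableAt (by simp)
    filter_upwards [hev, hev.eventually_nhds, hd] with z hz hz' hdz
    rw [oneFormInChart_eq_pullbackForm, oneFormInChart_eq_pullbackForm, ← pullbackForm_comp]
    · apply pullbackForm_congr
      filter_upwards [hz'] with w hw
      exact (ψ.left_inv hw).symm
    · exact mdifferentiableAt_chart_symm (ψ.map_source hz)
    · exact hdz
  -- Naturality: d commutes with the pullback under τ.
  have hpull := extDeriv_pullback (differentiableAt_ofSubsingleton (y := τ y) hα) hτd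
    (by simp; exact WithTop.coe_le_coe.2 le_top)
  have hcongr : (fun z => ContinuousAlternatingMap.ofSubsingleton ℝ E ℝ (0 : Fin 1)
        (oneFormInChart I α p z)) =ᶠ[𝓝 y]
      fun z => (ContinuousAlternatingMap.ofSubsingleton ℝ E ℝ (0 : Fin 1)
        (oneFormInChart I α q (τ z))).compContinuousLinearMap (fderiv ℝ τ z) := by
    filter_upwards [hform] with z hz
    rw [hz]
    rfl
  have hD : ∀ X : TangentSpace I q, chartDeriv I q q X = fderiv ℝ τ y (chartDeriv I p q X) :=
    fun X => mfderiv_apply_eq_chart (f := ψ) hy hτd' X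
  rw [← extDeriv_ofSubsingleton_apply hα', hcongr.extDeriv_eq, hpull,
    ContinuousAlternatingMap.compContinuousLinearMap_apply, extDerivOneForm_apply, hD, hD]
  congr 1
  funext i
  fin_cases i <;> rfl

end Charts

/-! ### Smoothness of fields, forms and metrics read in charts. -/

section Smoothness

variable {E : Type*} [NormedAddCommGroup E] [NormedSpace ℝ E]
  {H : Type*} [TopologicalSpace H] {I : ModelWithCorners ℝ E H}
  {N : Type*} [TopologicalSpace N] [ChartedSpace H N]

/-- The tangent bundle is trivialized by derivatives of charts. This is the bridge from smoothness
of bundle sections to smoothness of their chart expressions. -/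
theorem symmL_trivializationAt_eq_chartDerivSymm [IsManifold I 1 N] {p : N} {y : E}
    (hy : y ∈ (extChartAt I p).target) (a : E) :
    (trivializationAt E (TangentSpace I) p).symmL ℝ ((extChartAt I p).symm y) a =
      chartDerivSymm I p y a := by
  have hq : (extChartAt I p).symm y ∈ (chartAt H p).source := by
    rw [← extChartAt_source I]; exact (extChartAt I p).map_target hy
  apply chartDeriv_injective hy
  rw [chartDeriv_chartDerivSymm hy, chartDeriv,
    ← TangentBundle.continuousLinearMapAt_trivializationAt hq]
  exact Trivialization.continuousLinearMapAt_symmL _ hq a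

theorem trivializationAt_eq_chartDeriv [IsManifold I 1 N] {p q : N}
    (hq : q ∈ (chartAt H p).source) (X : TangentSpace I q) :
    (trivializationAt E (TangentSpace I) p ⟨q, X⟩).2 = chartDeriv I p q X := by
  rw [chartDeriv, ← TangentBundle.continuousLinearMapAt_trivializationAt hq,
    Trivialization.continuousLinearMapAt_apply, Trivialization.linearMapAt_apply, if_pos]
  exact hq

variable [IsManifold I ∞ N]

/-- The expression of the metric `g` in the preferred chart at `p`. -/
def NondegenerateMetric.inChart (g : NondegenerateMetric I N) (p : N) (y : E) :
    E →L[ℝ] E →L[ℝ] ℝ :=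
  ContinuousLinearMap.bilinearComp (E := E) (F := E) (E' := E) (F' := E)
    (g.toFun ((extChartAt I p).symm y)) (chartDerivSymm I p y) (chartDerivSymm I p y)

theorem NondegenerateMetric.inChart_apply (g : NondegenerateMetric I N) (p : N) (y a b : E) :
    g.inChart p y a b =
      g.toFun ((extChartAt I p).symm y) (chartDerivSymm I p y a) (chartDerivSymm I p y b) := rfl

theorem NondegenerateMetric.inChart_symm (g : NondegenerateMetric I N) (p : N) (y a b : E) :
    g.inChart p y a b = g.inChart p y b a := by
  rw [g.inChart_apply, g.inChart_apply, g.symm]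

theorem NondegenerateMetric.inChart_nondegenerate (g : NondegenerateMetric I N) {p : N} {y : E}
    (hy : y ∈ (extChartAt I p).target) (a : E) (h : ∀ b, g.inChart p y a b = 0) : a = 0 := by
  have h0 : chartDerivSymm I p y a = 0 := by
    apply g.nondegenerate
    intro w
    have := h (chartDeriv I p _ w)
    rwa [g.inChart_apply, chartDerivSymm_chartDeriv hy] at this
  rw [← chartDeriv_chartDerivSymm (I := I) hy a, h0, map_zero]

theorem contMDiffAt_symmL_const {p q : N} (hq : q ∈ (chartAt H p).source) (c : E) :
    ContMDiffAt I (I.prod 𝓘(ℝ, E)) ∞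
      (fun m => TotalSpace.mk' E (E := fun m : N => TangentSpace I m) m
        ((trivializationAt E (TangentSpace I) p).symmL ℝ m c)) q := by
  set e := trivializationAt E (TangentSpace I : N → Type _) p
  rw [e.contMDiffAt_section_iff (show q ∈ e.baseSet from hq)]
  refine (contMDiffAt_const (c := c)).congr_of_eventuallyEq ?_
  filter_upwards [e.open_baseSet.mem_nhds (show q ∈ e.baseSet from hq)] with m hm
  rw [Trivialization.symmL_apply _ hm, Trivialization.mk_symm _ hm]
  exact congrArg Prod.snd (e.apply_symm_apply' hm)

theorem NondegenerateMetric.contMDiffAt_apply (g : NondegenerateMetric I N)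
    {X Y : Π q : N, TangentSpace I q} {q : N}
    (hX : ContMDiffAt I (I.prod 𝓘(ℝ, E)) ∞
      (fun m => TotalSpace.mk' E (E := fun m : N => TangentSpace I m) m (X m)) q)
    (hY : ContMDiffAt I (I.prod 𝓘(ℝ, E)) ∞
      (fun m => TotalSpace.mk' E (E := fun m : N => TangentSpace I m) m (Y m)) q) :
    ContMDiffAt I 𝓘(ℝ, ℝ) ∞ (fun m => g.toFun m (X m) (Y m)) q := by
  have hg := (g.contMDiff q).clm_bundle_apply₂ hX hY
  exact (contMDiffAt_totalSpace.1 hg).2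

variable [I.Boundaryless]

/-- A vector field is smooth if and only if its expressions in the charts are. -/
theorem smoothVectorField_iff (X : Π q : N, TangentSpace I q) :
    SmoothVectorField I X ↔
      ∀ p : N, ContDiffAt ℝ ∞ (vectorFieldInChart I X p) (extChartAt I p p) := by
  refine forall_congr' fun p => ?_
  refine (contMDiffAt_section (IB := I) (F := E) (E := fun q : N => TangentSpace I q) p).trans ?_
  rw [contMDiffAt_iff_contDiffAt_chart]
  have heq : (fun q : N => (trivializationAt E (fun q : N => TangentSpace I q) p ⟨q, X q⟩).2) ∘
      (extChartAt I p).symm =ᶠ[𝓝 (extChartAt I p p)] vectorFieldInChart I X p := by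
    filter_upwards [eventually_chart_symm_mem_source (I := I) p] with y hy
    exact trivializationAt_eq_chartDeriv hy.2 _
  exact ⟨fun h => h.congr_of_eventuallyEq heq.symm, fun h => h.congr_of_eventuallyEq heq⟩

/-- A 1-form is smooth if and only if its expressions in the charts are. -/
theorem smoothOneForm_iff (α : Π q : N, TangentSpace I q →L[ℝ] ℝ) :
    SmoothOneForm I α ↔
      ∀ p : N, ContDiffAt ℝ ∞ (oneFormInChart I α p) (extChartAt I p p) := by
  refine forall_congr' fun p => ?_
  refine (contMDiffAt_section (IB := I) (F := E →L[ℝ] ℝ)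
    (E := fun q : N => TangentSpace I q →L[ℝ] Bundle.Trivial N ℝ q) p).trans ?_
  rw [contMDiffAt_iff_contDiffAt_chart]
  have heq : (fun q : N => (trivializationAt (E →L[ℝ] ℝ)
        (fun q : N => TangentSpace I q →L[ℝ] Bundle.Trivial N ℝ q) p ⟨q, α q⟩).2) ∘
      (extChartAt I p).symm =ᶠ[𝓝 (extChartAt I p p)] oneFormInChart I α p := by
    filter_upwards [eventually_chart_symm_mem_source (I := I) p] with y hy
    ext a
    rw [oneFormInChart_apply, ← symmL_trivializationAt_eq_chartDerivSymm hy.1, Function.comp_apply,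
      hom_trivializationAt_apply, ContinuousLinearMap.inCoordinates]
    simp
    rfl
  exact ⟨fun h => h.congr_of_eventuallyEq heq.symm, fun h => h.congr_of_eventuallyEq heq⟩

/-- The coefficients are the metric evaluated on the coordinate frame fields, which are smooth
because they are constant in the trivialization. Smoothness is needed on the whole chart, not only
at its centre. -/
theorem NondegenerateMetric.contDiffOn_inChart_apply
    (g : NondegenerateMetric I N) (p : N) (a b : E) :
    ContDiffOn ℝ ∞ (fun z => g.inChart p z a b) (extChartAt I p).target := by
  intro y hy
  have hqs : (extChartAt I p).symm y ∈ (chartAt H p).source := by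
    rw [← extChartAt_source I]; exact (extChartAt I p).map_target hy
  have hg := g.contMDiffAt_apply (contMDiffAt_symmL_const (I := I) hqs a)
    (contMDiffAt_symmL_const (I := I) hqs b)
  have h2 : ContMDiffAt 𝓘(ℝ, E) I ∞ (extChartAt I p).symm y := by
    have := contMDiffWithinAt_extChartAt_symm_range (I := I) (n := ∞) p hy
    rwa [I.range_eq_univ, contMDiffWithinAt_univ] at this
  apply ContDiffAt.contDiffWithinAt
  rw [← contMDiffAt_iff_contDiffAt]
  refine (hg.comp y h2).congr_of_eventuallyEq ?_
  filter_upwards [(isOpen_extChartAt_target p).mem_nhds hy] with z hz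
  rw [g.inChart_apply, ← symmL_trivializationAt_eq_chartDerivSymm hz,
    ← symmL_trivializationAt_eq_chartDerivSymm hz]
  rfl

/-- In finite dimension, smoothness of an operator-valued map can be tested by evaluating on fixed
vectors. -/
theorem NondegenerateMetric.contDiffAt_inChart [FiniteDimensional ℝ E]
    (g : NondegenerateMetric I N) {p : N} {y : E} (hy : y ∈ (extChartAt I p).target) :
    ContDiffAt ℝ ∞ (g.inChart p) y := by
  have h : ContDiffOn ℝ ∞ (g.inChart p) (extChartAt I p).target :=
    contDiffOn_clm_apply.2 fun a => contDiffOn_clm_apply.2 (g.contDiffOn_inChart_apply p a)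
  exact h.contDiffAt ((isOpen_extChartAt_target p).mem_nhds hy)

end Smoothness

/-! ### Derivatives of G(w, dy) and G(w, w)/2 on the model space E × E. -/

section BilinearCalculus

variable {E : Type*} [NormedAddCommGroup E] [NormedSpace ℝ E]
  {F : Type*} [NormedAddCommGroup F] [NormedSpace ℝ F] {z : E × E}

theorem hasFDerivAt_clm_apply_snd {A : E → E →L[ℝ] F} (hA : DifferentiableAt ℝ A z.1) :
    HasFDerivAt (fun w : E × E => A w.1 w.2)
      ((A z.1).comp (ContinuousLinearMap.snd ℝ E E) +
        ((fderiv ℝ A z.1).comp (ContinuousLinearMap.fst ℝ E E)).flip z.2) z := by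
  have h0 : HasFDerivAt (fun w : E × E => A w.1)
      ((fderiv ℝ A z.1).comp (ContinuousLinearMap.fst ℝ E E)) z :=
    HasFDerivAt.comp (g := A) (f := Prod.fst) z hA.hasFDerivAt hasFDerivAt_fst
  exact h0.clm_apply hasFDerivAt_snd

theorem fderiv_clm_apply_snd {A : E → E →L[ℝ] F} (hA : DifferentiableAt ℝ A z.1) (ξ : E × E) :
    fderiv ℝ (fun w : E × E => A w.1 w.2) z ξ = fderiv ℝ A z.1 ξ.1 z.2 + A z.1 ξ.2 := by
  rw [(hasFDerivAt_clm_apply_snd hA).fderiv]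
  simp [add_comm]

theorem contDiffAt_fderiv_fst_apply_snd {f : E → F} (hf : ContDiffAt ℝ ∞ f z.1) :
    ContDiffAt ℝ ∞ (fun w : E × E => fderiv ℝ f w.1 w.2) z := by
  have h1 : ContDiffAt ℝ ∞ (fderiv ℝ f) z.1 := hf.fderiv_right (by simp)
  have h2 : ContDiffAt ℝ ∞ (fun w : E × E => fderiv ℝ f w.1) z := h1.comp z contDiffAt_fst
  exact h2.clm_apply contDiffAt_snd

theorem contDiffAt_fderiv_fst_apply {f : E → F} (hf : ContDiffAt ℝ ∞ f z.1) (c : E) :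
    ContDiffAt ℝ ∞ (fun w : E × E => fderiv ℝ f w.1 c) z := by
  have h1 : ContDiffAt ℝ ∞ (fderiv ℝ f) z.1 := hf.fderiv_right (by simp)
  have h2 : ContDiffAt ℝ ∞ (fun w : E × E => fderiv ℝ f w.1) z := h1.comp z contDiffAt_fst
  exact h2.clm_apply contDiffAt_const

variable {G : E → E →L[ℝ] E →L[ℝ] ℝ}

theorem differentiableAt_bilinear_snd_comp_fst (hG : DifferentiableAt ℝ G z.1) :
    DifferentiableAt ℝ (fun w : E × E => (G w.1 w.2).comp (ContinuousLinearMap.fst ℝ E E)) z :=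
  (hasFDerivAt_clm_apply_snd hG).differentiableAt.clm_comp (differentiableAt_const _)

theorem fderiv_bilinear_snd_comp_fst (hG : DifferentiableAt ℝ G z.1) (ξ η : E × E) :
    fderiv ℝ (fun w : E × E => (G w.1 w.2).comp (ContinuousLinearMap.fst ℝ E E)) z ξ η =
      fderiv ℝ G z.1 ξ.1 z.2 η.1 + G z.1 ξ.2 η.1 := by
  rw [fderiv_clm_comp (hasFDerivAt_clm_apply_snd hG).differentiableAt (differentiableAt_const _),
    ← add_apply, ← fderiv_clm_apply_snd hG]
  simp

theorem differentiableAt_half_quadratic (hG : DifferentiableAt ℝ G z.1) :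
    DifferentiableAt ℝ (fun w : E × E => (1 / 2) * G w.1 w.2 w.2) z :=
  ((hasFDerivAt_clm_apply_snd hG).differentiableAt.clm_apply differentiableAt_snd).const_mul _

theorem fderiv_half_quadratic (hG : DifferentiableAt ℝ G z.1)
    (hs : ∀ a b, G z.1 a b = G z.1 b a) (η : E × E) :
    fderiv ℝ (fun w : E × E => (1 / 2) * G w.1 w.2 w.2) z η =
      (1 / 2) * fderiv ℝ G z.1 η.1 z.2 z.2 + G z.1 z.2 η.2 := by
  have h := (hasFDerivAt_clm_apply_snd hG).differentiableAt
  rw [fderiv_const_mul (h.clm_apply differentiableAt_snd),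
    fderiv_clm_apply h differentiableAt_snd, fderiv_snd]
  simp only [smul_apply, add_apply, ContinuousLinearMap.comp_apply, ContinuousLinearMap.flip_apply,
    fderiv_clm_apply_snd hG, ContinuousLinearMap.coe_snd', hs η.2 z.2, smul_eq_mul]
  ring

theorem contDiffAt_christoffel_apply (hG : ContDiffAt ℝ ∞ G z.1) (c : E) :
    ContDiffAt ℝ ∞ (fun w : E × E => fderiv ℝ G w.1 w.2 w.2 c -
      (1 / 2) * fderiv ℝ G w.1 c w.2 w.2) z :=
  (((contDiffAt_fderiv_fst_apply_snd hG).clm_apply contDiffAt_snd).clm_apply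
    contDiffAt_const).sub (contDiffAt_const.mul
      (((contDiffAt_fderiv_fst_apply hG c).clm_apply contDiffAt_snd).clm_apply contDiffAt_snd))

end BilinearCalculus

/-! ### Charts of the tangent bundle. -/

section TangentCharts

variable {E : Type*} [NormedAddCommGroup E] [NormedSpace ℝ E]
  {H : Type*} [TopologicalSpace H] {I : ModelWithCorners ℝ E H}
  {M : Type*} [TopologicalSpace M] [ChartedSpace H M]

theorem chartDeriv_injective_of_mem_source [IsManifold I 1 M] {p q : M}
    (hq : q ∈ (chartAt H p).source) : Function.Injective (chartDeriv I p q) := by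
  obtain ⟨y, hy, rfl⟩ := exists_chart_point (I := I) hq
  exact chartDeriv_injective hy

variable [IsManifold I 1 M]

/-- The charts of `TM` are the tangent maps of the charts of `M`; this is where the coordinates (y,
w) come from. -/
theorem extChartAt_tangent_apply {p v : TangentBundle I M}
    (hv : v.proj ∈ (chartAt H p.proj).source) :
    extChartAt I.tangent p v =
      (extChartAt I p.proj v.proj, chartDeriv I p.proj v.proj v.snd) := by
  rw [← trivializationAt_eq_chartDeriv hv]
  exact congrFun (congrArg PartialEquiv.toFun (FiberBundle.extChartAt (IB := I) p)) v

theorem extChartAt_tangent_source (p : TangentBundle I M) :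
    (extChartAt I.tangent p).source = {v | v.proj ∈ (chartAt H p.proj).source} := by
  ext v
  rw [extChartAt_source]
  exact TangentBundle.mem_chart_source_iff v p

theorem symm_proj_mem_source {p : TangentBundle I M} {z : E × E}
    (hz : z ∈ (extChartAt I.tangent p).target) :
    ((extChartAt I.tangent p).symm z).proj ∈ (chartAt H p.proj).source := by
  have := (extChartAt I.tangent p).map_target hz
  rwa [extChartAt_tangent_source] at this

theorem tangent_chart_fst {p : TangentBundle I M} {z : E × E}
    (hz : z ∈ (extChartAt I.tangent p).target) :
    extChartAt I p.proj ((extChartAt I.tangent p).symm z).proj = z.1 := by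
  have := (extChartAt I.tangent p).right_inv hz
  rw [extChartAt_tangent_apply (symm_proj_mem_source hz)] at this
  exact congrArg Prod.fst this

theorem tangent_chart_snd {p : TangentBundle I M} {z : E × E}
    (hz : z ∈ (extChartAt I.tangent p).target) :
    chartDeriv I p.proj ((extChartAt I.tangent p).symm z).proj
      ((extChartAt I.tangent p).symm z).snd = z.2 := by
  have := (extChartAt I.tangent p).right_inv hz
  rw [extChartAt_tangent_apply (symm_proj_mem_source hz)] at this
  exact congrArg Prod.snd this

theorem fst_mem_target {p : TangentBundle I M} {z : E × E}
    (hz : z ∈ (extChartAt I.tangent p).target) : z.1 ∈ (extChartAt I p.proj).target := by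
  rw [← tangent_chart_fst hz]
  apply (extChartAt I p.proj).map_source
  rw [extChartAt_source]
  exact symm_proj_mem_source hz

/-- In the charts of `TM`, the tangent map of the projection is the first projection. -/
theorem chartDeriv_projTangentMap [IsManifold I.tangent 1 (TangentBundle I M)]
    [ContMDiffVectorBundle 1 E (TangentSpace I : M → Type _) I]
    {p v : TangentBundle I M}
    (hv : v.proj ∈ (chartAt H p.proj).source) (Y : TangentSpace I.tangent v) :
    chartDeriv I p.proj v.proj (projTangentMap I v Y) = (chartDeriv I.tangent p v Y).1 := by
  have hvs : v ∈ (chartAt (ModelProd H E) p).source :=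
    (TangentBundle.mem_chart_source_iff v p).2 hv
  have hproj : MDifferentiableAt I.tangent I (fun w : TangentBundle I M => w.proj) v :=
    mdifferentiableAt_proj (TangentSpace I : M → Type _)
  have h1 : MDifferentiableAt I 𝓘(ℝ, E) (extChartAt I p.proj) v.proj :=
    mdifferentiableAt_extChartAt hv
  have h2 : MDifferentiableAt I.tangent 𝓘(ℝ, E × E) (extChartAt I.tangent p) v :=
    mdifferentiableAt_extChartAt hvs
  have h3 : MDifferentiableAt 𝓘(ℝ, E × E) 𝓘(ℝ, E) (Prod.fst : E × E → E)
    (extChartAt I.tangent p v) := differentiableAt_fst.mdifferentiableAt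
  have he : (extChartAt I p.proj ∘ fun w : TangentBundle I M => w.proj) =ᶠ[𝓝 v]
      Prod.fst ∘ extChartAt I.tangent p := by
    filter_upwards [(chartAt (ModelProd H E) p).open_source.mem_nhds hvs] with w hw
    rw [Function.comp_apply, Function.comp_apply,
      extChartAt_tangent_apply ((TangentBundle.mem_chart_source_iff w p).1 hw)]
  have h4 := he.mfderiv_eq (I := I.tangent) (I' := 𝓘(ℝ, E))
  rw [mfderiv_comp v h1 hproj, mfderiv_comp v h3 h2, mfderiv_eq_fderiv, fderiv_fst] at h4
  exact DFunLike.congr_fun h4 Y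

end TangentCharts

/-! ### The Liouville form, the symplectic form and the kinetic energy in coordinates. -/

section Liouville

variable {E : Type*} [NormedAddCommGroup E] [NormedSpace ℝ E]
  {H : Type*} [TopologicalSpace H] {I : ModelWithCorners ℝ E H}
  {M : Type*} [TopologicalSpace M] [ChartedSpace H M] [IsManifold I ∞ M]

theorem NondegenerateMetric.apply_eq_inChart (g : NondegenerateMetric I M)
    {p q : M} (hq : q ∈ (chartAt H p).source) (X Y : TangentSpace I q) :
    g.toFun q X Y =
      g.inChart p (extChartAt I p q) (chartDeriv I p q X) (chartDeriv I p q Y) := by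
  obtain ⟨y, hy, rfl⟩ := exists_chart_point (I := I) hq
  rw [(extChartAt I p).right_inv hy, g.inChart_apply, chartDerivSymm_chartDeriv hy,
    chartDerivSymm_chartDeriv hy]

theorem NondegenerateMetric.liouvilleForm_inChart (g : NondegenerateMetric I M)
    {p : TangentBundle I M} {z : E × E} (hz : z ∈ (extChartAt I.tangent p).target) :
    oneFormInChart I.tangent g.liouvilleForm p z =
      (g.inChart p.proj z.1 z.2).comp (ContinuousLinearMap.fst ℝ E E) := by
  have : ContMDiffVectorBundle 1 E (TangentSpace I : M → Type _) I :=
    ContMDiffVectorBundle.of_le (n := ∞) (by simp)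
  refine ContinuousLinearMap.ext fun a => ?_
  have hs := symm_proj_mem_source hz
  rw [oneFormInChart_apply, NondegenerateMetric.liouvilleForm, ContinuousLinearMap.comp_apply,
    g.apply_eq_inChart hs, chartDeriv_projTangentMap hs, chartDeriv_chartDerivSymm hz,
    tangent_chart_fst hz, tangent_chart_snd hz]
  rfl

theorem NondegenerateMetric.kineticEnergy_inChart (g : NondegenerateMetric I M)
    {p : TangentBundle I M} {z : E × E} (hz : z ∈ (extChartAt I.tangent p).target) :
    g.kineticEnergy ((extChartAt I.tangent p).symm z) =
      (1 / 2) * g.inChart p.proj z.1 z.2 z.2 := by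
  rw [NondegenerateMetric.kineticEnergy, g.apply_eq_inChart (symm_proj_mem_source hz),
    tangent_chart_fst hz, tangent_chart_snd hz]

/-- The tangent vector `X` at `v` is an acceleration if and only if its expression in a chart is
`(w, b)`, where `(y, w)` is the expression of `v`. -/
theorem projTangentMap_eq_iff {p : TangentBundle I M} {z : E × E}
    (hz : z ∈ (extChartAt I.tangent p).target)
    (X : TangentSpace I.tangent ((extChartAt I.tangent p).symm z)) :
    projTangentMap I ((extChartAt I.tangent p).symm z) X = ((extChartAt I.tangent p).symm z).snd ↔
      (chartDeriv I.tangent p ((extChartAt I.tangent p).symm z) X).1 = z.2 := by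
  have : ContMDiffVectorBundle 1 E (TangentSpace I : M → Type _) I :=
    ContMDiffVectorBundle.of_le (n := ∞) (by simp)
  have hs := symm_proj_mem_source hz
  rw [← (chartDeriv_injective_of_mem_source hs).eq_iff, chartDeriv_projTangentMap hs,
    tangent_chart_snd hz]

theorem projTangentMap_eq_zero_iff {p : TangentBundle I M} {z : E × E}
    (hz : z ∈ (extChartAt I.tangent p).target)
    (X : TangentSpace I.tangent ((extChartAt I.tangent p).symm z)) :
    projTangentMap I ((extChartAt I.tangent p).symm z) X = 0 ↔
      (chartDeriv I.tangent p ((extChartAt I.tangent p).symm z) X).1 = 0 := by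
  have : ContMDiffVectorBundle 1 E (TangentSpace I : M → Type _) I :=
    ContMDiffVectorBundle.of_le (n := ∞) (by simp)
  have hs := symm_proj_mem_source hz
  rw [← (chartDeriv_injective_of_mem_source hs).eq_iff, chartDeriv_projTangentMap hs, map_zero]

/-- The form `c ↦ (∂_w G)(w, c) - (∂_c G)(w, w) / 2` at the point `z = (y, w)` of a chart of `TM`:
the Christoffel symbols of the first kind, contracted twice with `w`. -/
def NondegenerateMetric.christoffelForm (g : NondegenerateMetric I M) (p : M) (z : E × E) :
    E →L[ℝ] ℝ :=
  fderiv ℝ (g.inChart p) z.1 z.2 z.2 - (1 / 2 : ℝ) • ((fderiv ℝ (g.inChart p) z.1).flip z.2).flip z.2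

theorem NondegenerateMetric.christoffelForm_apply (g : NondegenerateMetric I M) (p : M)
    (z : E × E) (c : E) :
    g.christoffelForm p z c = fderiv ℝ (g.inChart p) z.1 z.2 z.2 c -
      (1 / 2) * fderiv ℝ (g.inChart p) z.1 c z.2 z.2 := by
  simp [NondegenerateMetric.christoffelForm]

variable [I.Boundaryless]

theorem NondegenerateMetric.liouvilleForm_inChart_eventuallyEq (g : NondegenerateMetric I M)
    {p : TangentBundle I M} {z : E × E} (hz : z ∈ (extChartAt I.tangent p).target) :
    oneFormInChart I.tangent g.liouvilleForm p =ᶠ[𝓝 z]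
      fun z => (g.inChart p.proj z.1 z.2).comp (ContinuousLinearMap.fst ℝ E E) := by
  filter_upwards [(isOpen_extChartAt_target p).mem_nhds hz] with w hw
  exact g.liouvilleForm_inChart hw

theorem NondegenerateMetric.kineticEnergy_inChart_eventuallyEq (g : NondegenerateMetric I M)
    {p : TangentBundle I M} {z : E × E} (hz : z ∈ (extChartAt I.tangent p).target) :
    g.kineticEnergy ∘ (extChartAt I.tangent p).symm =ᶠ[𝓝 z]
      fun z => (1 / 2) * g.inChart p.proj z.1 z.2 z.2 := by
  filter_upwards [(isOpen_extChartAt_target p).mem_nhds hz] with w hw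
  exact g.kineticEnergy_inChart hw

variable [FiniteDimensional ℝ E]

theorem NondegenerateMetric.differentiableAt_inChart (g : NondegenerateMetric I M) {p : M} {y : E}
    (hy : y ∈ (extChartAt I p).target) : DifferentiableAt ℝ (g.inChart p) y :=
  (g.contDiffAt_inChart hy).differentiableAt (by simp)

theorem NondegenerateMetric.differentiableAt_liouvilleForm_inChart (g : NondegenerateMetric I M)
    {p : TangentBundle I M} {z : E × E} (hz : z ∈ (extChartAt I.tangent p).target) :
    DifferentiableAt ℝ (oneFormInChart I.tangent g.liouvilleForm p) z :=
  (differentiableAt_bilinear_snd_comp_fst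
    (g.differentiableAt_inChart (fst_mem_target hz))).congr_of_eventuallyEq
    (g.liouvilleForm_inChart_eventuallyEq hz)

/-- Antisymmetrize the derivative of θ = G(w, dy). The formula holds at every point of one fixed
chart by `extDerivOneForm_apply_eq_chart`. -/
theorem NondegenerateMetric.symplecticForm_inChart (g : NondegenerateMetric I M)
    {p : TangentBundle I M} {z : E × E} (hz : z ∈ (extChartAt I.tangent p).target)
    (X Y : TangentSpace I.tangent ((extChartAt I.tangent p).symm z)) {ξ η : E × E}
    (hX : chartDeriv I.tangent p ((extChartAt I.tangent p).symm z) X = ξ)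
    (hY : chartDeriv I.tangent p ((extChartAt I.tangent p).symm z) Y = η) :
    g.symplecticForm ((extChartAt I.tangent p).symm z) ![X, Y] =
      (fderiv ℝ (g.inChart p.proj) z.1 ξ.1 z.2 η.1 + g.inChart p.proj z.1 ξ.2 η.1) -
        (fderiv ℝ (g.inChart p.proj) z.1 η.1 z.2 ξ.1 + g.inChart p.proj z.1 η.2 ξ.1) := by
  have hG := g.differentiableAt_inChart (fst_mem_target hz)
  rw [NondegenerateMetric.symplecticForm, extDerivOneForm_apply_eq_chart hz
    (g.differentiableAt_liouvilleForm_inChart (mem_extChartAt_target _))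
    (g.differentiableAt_liouvilleForm_inChart hz), hX, hY,
    (g.liouvilleForm_inChart_eventuallyEq hz).fderiv_eq, fderiv_bilinear_snd_comp_fst hG,
    fderiv_bilinear_snd_comp_fst hG]

theorem NondegenerateMetric.differential_kineticEnergy_inChart (g : NondegenerateMetric I M)
    {p : TangentBundle I M} {z : E × E} (hz : z ∈ (extChartAt I.tangent p).target)
    (Y : TangentSpace I.tangent ((extChartAt I.tangent p).symm z)) {η : E × E}
    (hY : chartDeriv I.tangent p ((extChartAt I.tangent p).symm z) Y = η) :
    differential I.tangent g.kineticEnergy ((extChartAt I.tangent p).symm z) Y =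
      (1 / 2) * fderiv ℝ (g.inChart p.proj) z.1 η.1 z.2 z.2 + g.inChart p.proj z.1 z.2 η.2 := by
  have hG := g.differentiableAt_inChart (fst_mem_target hz)
  have he := g.kineticEnergy_inChart_eventuallyEq hz
  refine (mfderiv_apply_eq_chart hz
    ((differentiableAt_half_quadratic hG).congr_of_eventuallyEq he) Y).trans ?_
  rw [hY, he.fderiv_eq, fderiv_half_quadratic hG (g.inChart_symm p.proj z.1)]

theorem NondegenerateMetric.contDiffAt_christoffelForm (g : NondegenerateMetric I M)
    {p : M} {z : E × E} (hz : z.1 ∈ (extChartAt I p).target) :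
    ContDiffAt ℝ ∞ (g.christoffelForm p) z := by
  have h : ContDiffOn ℝ ∞ (g.christoffelForm p) (Prod.fst ⁻¹' (extChartAt I p).target) := by
    refine contDiffOn_clm_apply.2 fun c w hw => ?_
    simp only [g.christoffelForm_apply]
    exact (contDiffAt_christoffel_apply (g.contDiffAt_inChart hw) c).contDiffWithinAt
  exact h.contDiffAt (((isOpen_extChartAt_target p).preimage continuous_fst).mem_nhds hz)

/-- The left-hand side of the Newton equation without forces, for an acceleration. -/
theorem NondegenerateMetric.symplecticForm_add_differential (g : NondegenerateMetric I M)
    {p : TangentBundle I M} {z : E × E} (hz : z ∈ (extChartAt I.tangent p).target)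
    (X Y : TangentSpace I.tangent ((extChartAt I.tangent p).symm z)) {b : E}
    (hX : chartDeriv I.tangent p ((extChartAt I.tangent p).symm z) X = (z.2, b)) :
    g.symplecticForm ((extChartAt I.tangent p).symm z) ![X, Y] +
      differential I.tangent g.kineticEnergy ((extChartAt I.tangent p).symm z) Y =
    (g.inChart p.proj z.1 b + g.christoffelForm p.proj z)
      (chartDeriv I.tangent p ((extChartAt I.tangent p).symm z) Y).1 := by
  -- As the base component of `X` is w, the term -G(η₂, w) of ω₂ cancels the term G(w, η₂) of dT, η₂
  -- being the fibre component of `Y`. The terms (∂_{η₁} G)(w, w), with coefficients -1 and 1/2,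
  -- combine into the second term of Γ.
  rw [g.symplecticForm_inChart hz X Y hX rfl, g.differential_kineticEnergy_inChart hz Y rfl,
    add_apply, g.christoffelForm_apply, g.inChart_symm _ _ z.2]
  ring

end Liouville

theorem contDiffAt_inverse_apply {W F F' : Type*} [NormedAddCommGroup W] [NormedSpace ℝ W]
    [NormedAddCommGroup F] [NormedSpace ℝ F] [CompleteSpace F]
    [NormedAddCommGroup F'] [NormedSpace ℝ F'] {n : WithTop ℕ∞} {A : W → F →L[ℝ] F'} {c : W → F'}
    {w : W} (hA : ContDiffAt ℝ n A w) (hw : (A w).IsInvertible) (hc : ContDiffAt ℝ n c w) :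
    ContDiffAt ℝ n (fun w => (A w).inverse (c w)) w := by
  obtain ⟨e, he⟩ := hw
  have h : ContDiffAt ℝ n (ContinuousLinearMap.inverse : (F →L[ℝ] F') → F' →L[ℝ] F) (A w) :=
    he ▸ contDiffAt_map_inverse e
  exact (h.comp w hA).clm_apply hc

/-! ### The Newton equation at a point as a linear equation for the acceleration. -/

section Newton

variable {E : Type*} [NormedAddCommGroup E] [NormedSpace ℝ E]
  {H : Type*} [TopologicalSpace H] {I : ModelWithCorners ℝ E H}
  {M : Type*} [TopologicalSpace M] [ChartedSpace H M]

theorem exists_chartDeriv_eq [IsManifold I 1 M] {p q : M}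
    (hq : q ∈ (chartAt H p).source) (ξ : E) : ∃ X, chartDeriv I p q X = ξ := by
  obtain ⟨y, hy, rfl⟩ := exists_chart_point (I := I) hq
  exact ⟨chartDerivSymm I p y ξ, chartDeriv_chartDerivSymm hy ξ⟩

theorem oneForm_apply_eq_inChart [IsManifold I 1 M] {p q : M} (hq : q ∈ (chartAt H p).source)
    (α : Π q : M, TangentSpace I q →L[ℝ] ℝ) (X : TangentSpace I q) :
    α q X = oneFormInChart I α p (extChartAt I p q) (chartDeriv I p q X) := by
  obtain ⟨y, hy, rfl⟩ := exists_chart_point (I := I) hq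
  rw [(extChartAt I p).right_inv hy, oneFormInChart_apply, chartDerivSymm_chartDeriv hy]

variable [IsManifold I ∞ M]

theorem projTangentMap_eq_iff_of_mem_source {p v : TangentBundle I M}
    (hv : v.proj ∈ (chartAt H p.proj).source) (X : TangentSpace I.tangent v) :
    projTangentMap I v X = v.snd ↔
      (chartDeriv I.tangent p v X).1 = (extChartAt I.tangent p v).2 := by
  obtain ⟨z, hz, rfl⟩ := exists_chart_point (I := I.tangent)
    ((TangentBundle.mem_chart_source_iff v p).2 hv)
  rw [(extChartAt I.tangent p).right_inv hz]
  exact projTangentMap_eq_iff hz X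

theorem projTangentMap_eq_zero_iff_of_mem_source {p v : TangentBundle I M}
    (hv : v.proj ∈ (chartAt H p.proj).source) (X : TangentSpace I.tangent v) :
    projTangentMap I v X = 0 ↔ (chartDeriv I.tangent p v X).1 = 0 := by
  obtain ⟨z, hz, rfl⟩ := exists_chart_point (I := I.tangent)
    ((TangentBundle.mem_chart_source_iff v p).2 hv)
  exact projTangentMap_eq_zero_iff hz X

/-- A horizontal form only depends on the base component of a vector in a chart. -/
theorem horizontal_apply_eq {p v : TangentBundle I M} (hv : v.proj ∈ (chartAt H p.proj).source)
    {α : Π v : TangentBundle I M, TangentSpace I.tangent v →L[ℝ] ℝ}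
    (hα : ∀ V : TangentSpace I.tangent v, projTangentMap I v V = 0 → α v V = 0)
    (Y : TangentSpace I.tangent v) :
    α v Y = (oneFormInChart I.tangent α p (extChartAt I.tangent p v)).comp
      (ContinuousLinearMap.inl ℝ E E) (chartDeriv I.tangent p v Y).1 := by
  have hv' := (TangentBundle.mem_chart_source_iff v p).2 hv
  -- `Y'` has the base component of `Y` and zero fibre component, so `Y - Y'` is vertical.
  obtain ⟨Y', hY'⟩ := exists_chartDeriv_eq (I := I.tangent) hv'
    (((chartDeriv I.tangent p v Y).1, 0) : E × E)
  have h0 : α v (Y - Y') = 0 := by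
    apply hα
    rw [projTangentMap_eq_zero_iff_of_mem_source hv, map_sub, hY', Prod.fst_sub, sub_self]
  rw [map_sub, sub_eq_zero] at h0
  rw [h0, oneForm_apply_eq_inChart hv', hY']
  rfl

/-- The acceleration, in a chart, of the second order equation with the horizontal form `α`. -/
def NondegenerateMetric.acceleration (g : NondegenerateMetric I M)
    (α : Π v : TangentBundle I M, TangentSpace I.tangent v →L[ℝ] ℝ) (p : TangentBundle I M)
    (z : E × E) : E :=
  (g.inChart p.proj z.1).inverse (-g.christoffelForm p.proj z -
    (oneFormInChart I.tangent α p z).comp (ContinuousLinearMap.inl ℝ E E))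

variable [FiniteDimensional ℝ E]

/-- Non-degeneracy is injectivity, and `E` and its dual have the same dimension. Without
invertibility the `inverse` in `acceleration` would be the default value 0. -/
theorem NondegenerateMetric.isInvertible_inChart (g : NondegenerateMetric I M) {p : M} {y : E}
    (hy : y ∈ (extChartAt I p).target) : (g.inChart p y).IsInvertible := by
  have hinj : Function.Injective (g.inChart p y) := by
    rw [injective_iff_map_eq_zero]
    exact fun a ha => g.inChart_nondegenerate hy a fun b => by rw [ha]; rfl
  have hfin : Module.finrank ℝ E = Module.finrank ℝ (E →L[ℝ] ℝ) := by
    rw [← (LinearMap.toContinuousLinearMap (𝕜 := ℝ) (E := E) (F' := ℝ)).finrank_eq]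
    exact (Subspace.dual_finrank_eq (K := ℝ) (V := E)).symm
  refine ⟨(LinearEquiv.ofInjectiveOfFinrankEq (g.inChart p y : E →ₗ[ℝ] E →L[ℝ] ℝ)
    hinj hfin).toContinuousLinearEquiv, ?_⟩
  ext a b
  rfl

theorem NondegenerateMetric.inChart_eq_iff_acceleration (g : NondegenerateMetric I M)
    (α : Π v : TangentBundle I M, TangentSpace I.tangent v →L[ℝ] ℝ) {p : TangentBundle I M}
    {z : E × E} (hz : z.1 ∈ (extChartAt I p.proj).target) (b : E) :
    b = g.acceleration α p z ↔
      ∀ c, (g.inChart p.proj z.1 b + g.christoffelForm p.proj z) c +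
        (oneFormInChart I.tangent α p z).comp (ContinuousLinearMap.inl ℝ E E) c = 0 := by
  obtain ⟨e, he⟩ := g.isInvertible_inChart hz
  rw [NondegenerateMetric.acceleration, ← he, ContinuousLinearMap.inverse_equiv,
    ContinuousLinearEquiv.coe_coe, ContinuousLinearEquiv.eq_symm_apply, eq_sub_iff_add_eq,
    eq_neg_iff_add_eq_zero, ContinuousLinearMap.ext_iff]
  refine forall_congr' fun c => ?_
  simp only [add_apply, zero_apply, ContinuousLinearEquiv.coe_coe]
  rw [add_right_comm]

variable [I.Boundaryless]

theorem NondegenerateMetric.newton_lhs_eq (g : NondegenerateMetric I M)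
    {p v : TangentBundle I M} (hv : v.proj ∈ (chartAt H p.proj).source)
    {X : TangentSpace I.tangent v} (hX : projTangentMap I v X = v.snd)
    (Y : TangentSpace I.tangent v) :
    g.symplecticForm v ![X, Y] + differential I.tangent g.kineticEnergy v Y =
      (g.inChart p.proj (extChartAt I.tangent p v).1 (chartDeriv I.tangent p v X).2 +
        g.christoffelForm p.proj (extChartAt I.tangent p v)) (chartDeriv I.tangent p v Y).1 := by
  obtain ⟨z, hz, rfl⟩ := exists_chart_point (I := I.tangent)
    ((TangentBundle.mem_chart_source_iff v p).2 hv)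
  rw [(extChartAt I.tangent p).right_inv hz]
  refine g.symplecticForm_add_differential hz X Y (Prod.ext ?_ rfl)
  exact (projTangentMap_eq_iff hz X).1 hX

/-- The Newton equation at `v`, in a chart. -/
theorem NondegenerateMetric.newton_iff_acceleration (g : NondegenerateMetric I M)
    {α : Π v : TangentBundle I M, TangentSpace I.tangent v →L[ℝ] ℝ}
    {p v : TangentBundle I M} (hv : v.proj ∈ (chartAt H p.proj).source)
    (hα : ∀ V : TangentSpace I.tangent v, projTangentMap I v V = 0 → α v V = 0)
    {X : TangentSpace I.tangent v} (hX : projTangentMap I v X = v.snd) :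
    (∀ Y, g.symplecticForm v ![X, Y] + differential I.tangent g.kineticEnergy v Y + α v Y = 0) ↔
      (chartDeriv I.tangent p v X).2 = g.acceleration α p (extChartAt I.tangent p v) := by
  have hv' := (TangentBundle.mem_chart_source_iff v p).2 hv
  have hz : (extChartAt I.tangent p v).1 ∈ (extChartAt I p.proj).target := by
    apply fst_mem_target
    apply (extChartAt I.tangent p).map_source
    rwa [extChartAt_source]
  rw [g.inChart_eq_iff_acceleration α hz]
  simp only [g.newton_lhs_eq hv hX, horizontal_apply_eq hv hα]
  constructor
  -- Base components of tangent vectors at `v` exhaust `E`, so testing on all `Y` amounts to testing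
  -- on all `c`.
  · intro h c
    obtain ⟨Y, hY⟩ := exists_chartDeriv_eq (I := I.tangent) hv' ((c, 0) : E × E)
    have := h Y
    rwa [hY] at this
  · exact fun h Y => h _

theorem NondegenerateMetric.contDiffAt_acceleration (g : NondegenerateMetric I M)
    {α : Π v : TangentBundle I M, TangentSpace I.tangent v →L[ℝ] ℝ} {p : TangentBundle I M}
    {z : E × E} (hz : z.1 ∈ (extChartAt I p.proj).target)
    (hα : ContDiffAt ℝ ∞ (oneFormInChart I.tangent α p) z) :
    ContDiffAt ℝ ∞ (g.acceleration α p) z := by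
  have : CompleteSpace E := FiniteDimensional.complete ℝ E
  have h : ContDiffAt ℝ ∞ (fun w : E × E => g.inChart p.proj w.1) z :=
    (g.contDiffAt_inChart hz).comp z contDiffAt_fst
  exact contDiffAt_inverse_apply h (g.isInvertible_inChart hz)
    ((g.contDiffAt_christoffelForm hz).neg.sub (hα.clm_comp contDiffAt_const))

end Newton

/-! ### The correspondence between second order equations and horizontal forms. -/

section Correspondence

variable {E : Type*} [NormedAddCommGroup E] [NormedSpace ℝ E]
  {H : Type*} [TopologicalSpace H] {I : ModelWithCorners ℝ E H}
  {M : Type*} [TopologicalSpace M] [ChartedSpace H M]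
  [IsManifold I ∞ M] [I.Boundaryless] [FiniteDimensional ℝ E]

/-- The horizontal 1-form that corresponds to the vector field `D` by the Newton equation. -/
def NondegenerateMetric.forceForm (g : NondegenerateMetric I M)
    (D : Π v : TangentBundle I M, TangentSpace I.tangent v) (v : TangentBundle I M) :
    TangentSpace I.tangent v →L[ℝ] ℝ :=
  -((g.inChart v.proj (extChartAt I.tangent v v).1 (chartDeriv I.tangent v v (D v)).2 +
    g.christoffelForm v.proj (extChartAt I.tangent v v)).comp
      ((ContinuousLinearMap.fst ℝ E E).comp (chartDeriv I.tangent v v)))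

theorem NondegenerateMetric.newtonEquation_forceForm (g : NondegenerateMetric I M)
    {D : Π v : TangentBundle I M, TangentSpace I.tangent v}
    (hD : ∀ v : TangentBundle I M, projTangentMap I v (D v) = v.snd) :
    NewtonEquation g D (g.forceForm D) := by
  intro v Y
  rw [g.newton_lhs_eq (mem_chart_source H v.proj) (hD v)]
  exact add_neg_cancel _

theorem NondegenerateMetric.oneFormInChart_eq_of_newtonEquation (g : NondegenerateMetric I M)
    {D : Π v : TangentBundle I M, TangentSpace I.tangent v}
    {α : Π v : TangentBundle I M, TangentSpace I.tangent v →L[ℝ] ℝ}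
    (hD : ∀ v : TangentBundle I M, projTangentMap I v (D v) = v.snd)
    (h : NewtonEquation g D α) {p : TangentBundle I M} {z : E × E}
    (hz : z ∈ (extChartAt I.tangent p).target) :
    oneFormInChart I.tangent α p z =
      -((g.inChart p.proj z.1 (vectorFieldInChart I.tangent D p z).2 +
        g.christoffelForm p.proj z).comp (ContinuousLinearMap.fst ℝ E E)) := by
  refine ContinuousLinearMap.ext fun η => ?_
  have h1 := h ((extChartAt I.tangent p).symm z) (chartDerivSymm I.tangent p z η)
  rw [g.newton_lhs_eq (symm_proj_mem_source hz) (hD _), chartDeriv_chartDerivSymm hz,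
    (extChartAt I.tangent p).right_inv hz] at h1
  exact eq_neg_of_add_eq_zero_right h1

/-- The equation forces α = -(G(b) + Γ) in dy throughout a chart: it is smooth because b, G and Γ
are, and it kills vertical vectors. Hence `forceForm`, built with a different chart at each point,
needs no separate gluing argument. -/
theorem NondegenerateMetric.isHorizontalForm_of_newtonEquation (g : NondegenerateMetric I M)
    {D : Π v : TangentBundle I M, TangentSpace I.tangent v}
    {α : Π v : TangentBundle I M, TangentSpace I.tangent v →L[ℝ] ℝ}
    (hD : IsSecondOrderEquation I D) (h : NewtonEquation g D α) : IsHorizontalForm I α := by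
  refine ⟨(smoothOneForm_iff α).2 fun p => ?_, fun v V hV => ?_⟩
  · have he : oneFormInChart I.tangent α p =ᶠ[𝓝 (extChartAt I.tangent p p)] fun z =>
        -((g.inChart p.proj z.1 (vectorFieldInChart I.tangent D p z).2 +
          g.christoffelForm p.proj z).comp (ContinuousLinearMap.fst ℝ E E)) := by
      filter_upwards [extChartAt_target_mem_nhds (I := I.tangent) p] with z hz
      exact g.oneFormInChart_eq_of_newtonEquation hD.2 h hz
    refine ContDiffAt.congr_of_eventuallyEq ?_ he
    have hp := fst_mem_target (mem_extChartAt_target (I := I.tangent) p)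
    have h1 : ContDiffAt ℝ ∞ (fun z : E × E => g.inChart p.proj z.1) (extChartAt I.tangent p p) :=
      (g.contDiffAt_inChart hp).comp _ contDiffAt_fst
    have h2 := ((smoothVectorField_iff D).1 hD.1 p).snd
    exact (((h1.clm_apply h2).add (g.contDiffAt_christoffelForm hp)).clm_comp contDiffAt_const).neg
  · have h1 := h v V
    have hv : v.proj ∈ (chartAt H v.proj).source := mem_chart_source H v.proj
    rwa [g.newton_lhs_eq hv (hD.2 v), (projTangentMap_eq_zero_iff_of_mem_source hv V).1 hV,
      map_zero, zero_add] at h1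

theorem NondegenerateMetric.existsUnique_horizontalForm (g : NondegenerateMetric I M)
    {D : Π v : TangentBundle I M, TangentSpace I.tangent v} (hD : IsSecondOrderEquation I D) :
    ∃! α : Π v : TangentBundle I M, TangentSpace I.tangent v →L[ℝ] ℝ,
      IsHorizontalForm I α ∧ NewtonEquation g D α := by
  have h := g.newtonEquation_forceForm hD.2
  refine ⟨g.forceForm D, ⟨g.isHorizontalForm_of_newtonEquation hD h, h⟩, ?_⟩
  rintro α ⟨-, hα⟩
  funext v
  ext Y
  exact add_left_cancel ((hα v Y).trans (h v Y).symm)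

theorem NondegenerateMetric.existsUnique_secondOrderEquation (g : NondegenerateMetric I M)
    {α : Π v : TangentBundle I M, TangentSpace I.tangent v →L[ℝ] ℝ} (hα : IsHorizontalForm I α) :
    ∃! D : Π v : TangentBundle I M, TangentSpace I.tangent v,
      IsSecondOrderEquation I D ∧ NewtonEquation g D α := by
  have hsrc : ∀ v : TangentBundle I M, v ∈ (chartAt (ModelProd H E) v).source :=
    fun v => mem_chart_source _ v
  have hsrc' : ∀ v : TangentBundle I M, v.proj ∈ (chartAt H v.proj).source :=
    fun v => mem_chart_source H v.proj
  -- `D v` is the vector (w, b) in the chart centred at `v`, with b the solution of the linear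
  -- equation there.
  choose D hD using fun v : TangentBundle I M => exists_chartDeriv_eq (I := I.tangent) (hsrc v)
    (((extChartAt I.tangent v v).2, g.acceleration α v (extChartAt I.tangent v v)) : E × E)
  have hD2 : ∀ v : TangentBundle I M, projTangentMap I v (D v) = v.snd := fun v =>
    (projTangentMap_eq_iff_of_mem_source (hsrc' v) _).2 (by rw [hD])
  have hN : NewtonEquation g D α := fun v =>
    (g.newton_iff_acceleration (hsrc' v) (hα.2 v) (hD2 v)).2 (by rw [hD])
  refine ⟨D, ⟨⟨(smoothVectorField_iff D).2 fun p => ?_, hD2⟩, hN⟩, ?_⟩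
  -- The two properties of `D`, being an acceleration and solving the Newton equation, are
  -- chart-free. Read in the chart at `p`, they determine both components at all nearby points.
  · have he : vectorFieldInChart I.tangent D p =ᶠ[𝓝 (extChartAt I.tangent p p)] fun z =>
        (z.2, g.acceleration α p z) := by
      filter_upwards [extChartAt_target_mem_nhds (I := I.tangent) p] with z hz
      have hs := symm_proj_mem_source hz
      have h1 := (projTangentMap_eq_iff_of_mem_source hs _).1 (hD2 _)
      have h2 := (g.newton_iff_acceleration hs (hα.2 _) (hD2 _)).1 (hN _)
      rw [(extChartAt I.tangent p).right_inv hz] at h1 h2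
      exact Prod.ext h1 h2
    refine ContDiffAt.congr_of_eventuallyEq ?_ he
    have hp := fst_mem_target (mem_extChartAt_target (I := I.tangent) p)
    exact contDiffAt_snd.prodMk (g.contDiffAt_acceleration hp ((smoothOneForm_iff α).1 hα.1 p))
  · rintro D' ⟨hD', hN'⟩
    funext v
    apply chartDeriv_injective_of_mem_source (I := I.tangent) (hsrc v)
    rw [hD]
    exact Prod.ext ((projTangentMap_eq_iff_of_mem_source (hsrc' v) _).1 (hD'.2 v))
      ((g.newton_iff_acceleration (hsrc' v) (hα.2 v) (hD'.2 v)).1 (hN' v))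

end Correspondence

/-! ### Intermediate integrals. -/

section IntermediateIntegral

variable {E : Type*} [NormedAddCommGroup E] [NormedSpace ℝ E]
  {G : E → E →L[ℝ] E →L[ℝ] ℝ} {f : E → E} {y : E}

theorem fderiv_apply_bilinear (hG : DifferentiableAt ℝ G y) (hf : DifferentiableAt ℝ f y) :
    DifferentiableAt ℝ (fun x => G x (f x)) y ∧ ∀ a,
      fderiv ℝ (fun x => G x (f x)) y a = fderiv ℝ G y a (f y) + G y (fderiv ℝ f y a) := by
  refine ⟨hG.clm_apply hf, fun a => ?_⟩
  rw [fderiv_clm_apply hG hf]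
  simp [add_comm]

theorem fderiv_half_quadratic_comp (hG : DifferentiableAt ℝ G y) (hf : DifferentiableAt ℝ f y)
    (hs : ∀ a b, G y a b = G y b a) :
    DifferentiableAt ℝ (fun x => (1 / 2) * G x (f x) (f x)) y ∧ ∀ a,
      fderiv ℝ (fun x => (1 / 2) * G x (f x) (f x)) y a =
        (1 / 2) * fderiv ℝ G y a (f y) (f y) + G y (f y) (fderiv ℝ f y a) := by
  have h := fderiv_apply_bilinear hG hf
  refine ⟨(h.1.clm_apply hf).const_mul _, fun a => ?_⟩
  rw [fderiv_const_mul (h.1.clm_apply hf), fderiv_clm_apply h.1 hf]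
  simp only [smul_apply, add_apply, ContinuousLinearMap.comp_apply, ContinuousLinearMap.flip_apply,
    h.2, hs (fderiv ℝ f y a), smul_eq_mul]
  ring

variable {H : Type*} [TopologicalSpace H] {I : ModelWithCorners ℝ E H}
  {M : Type*} [TopologicalSpace M] [ChartedSpace H M]

theorem chartDeriv_self_apply_eq (u : Π x : M, TangentSpace I x) (x : M) :
    chartDeriv I x x (u x) = vectorFieldInChart I u x (extChartAt I x x) := by
  rw [vectorFieldInChart, extChartAt_to_inv]

variable [IsManifold I ∞ M]

theorem mfderiv_apply_eq_chart_self {F : Type*} [NormedAddCommGroup F] [NormedSpace ℝ F]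
    {f : M → F} {p : M}
    (hf : DifferentiableAt ℝ (f ∘ (extChartAt I p).symm) (extChartAt I p p))
    (X : TangentSpace I p) :
    mfderiv I 𝓘(ℝ, F) f p X =
      fderiv ℝ (f ∘ (extChartAt I p).symm) (extChartAt I p p) (chartDeriv I p p X) := by
  -- The point is generalized so that it can be replaced by `(extChartAt I p).symm y`; at `p` itself
  -- the two agree only propositionally, and the tangent spaces depend on the point.
  have key : ∀ q ∈ (extChartAt I p).source,
      DifferentiableAt ℝ (f ∘ (extChartAt I p).symm) (extChartAt I p q) →
      ∀ X : TangentSpace I q, mfderiv I 𝓘(ℝ, F) f q X =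
        fderiv ℝ (f ∘ (extChartAt I p).symm) (extChartAt I p q) (chartDeriv I p q X) := by
    intro q hq
    obtain ⟨y, hy, rfl⟩ := exists_chart_point (I := I) (by rwa [extChartAt_source] at hq)
    rw [(extChartAt I p).right_inv hy]
    exact fun h X => mfderiv_apply_eq_chart hy h X
  exact key p (mem_extChartAt_source p) hf X

variable [I.Boundaryless]

theorem SmoothVectorField.differentiableAt_inChart {u : Π x : M, TangentSpace I x}
    (hu : SmoothVectorField I u) (x : M) :
    DifferentiableAt ℝ (vectorFieldInChart I u x) (extChartAt I x x) :=
  ((smoothVectorField_iff u).1 hu x).differentiableAt (by simp)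

/-- The tangent map of a section, in the charts. -/
theorem chartDeriv_fieldTangentMap {u : Π x : M, TangentSpace I x} (hu : SmoothVectorField I u)
    (x : M) (Y : TangentSpace I x) :
    chartDeriv I.tangent (fieldSection I u x) (fieldSection I u x) (fieldTangentMap I u x Y) =
      (chartDeriv I x x Y,
        fderiv ℝ (vectorFieldInChart I u x) (extChartAt I x x) (chartDeriv I x x Y)) := by
  have hud := SmoothVectorField.differentiableAt_inChart hu x
  have hsec : MDifferentiableAt I I.tangent (fieldSection I u) x :=
    (hu x).mdifferentiableAt (by simp)
  have hch : MDifferentiableAt I.tangent 𝓘(ℝ, E × E)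
      (extChartAt I.tangent (fieldSection I u x)) (fieldSection I u x) :=
    mdifferentiableAt_extChartAt (mem_chart_source _ _)
  have he : (extChartAt I.tangent (fieldSection I u x) ∘ fieldSection I u) ∘
      (extChartAt I x).symm =ᶠ[𝓝 (extChartAt I x x)]
        fun y => (y, vectorFieldInChart I u x y) := by
    filter_upwards [eventually_chart_symm_mem_source (I := I) x] with y hy
    rw [Function.comp_apply, Function.comp_apply, extChartAt_tangent_apply hy.2]
    exact Prod.ext ((extChartAt I x).right_inv hy.1) rfl
  have hd : HasFDerivAt (fun y => (y, vectorFieldInChart I u x y))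
      ((ContinuousLinearMap.id ℝ E).prod
        (fderiv ℝ (vectorFieldInChart I u x) (extChartAt I x x))) (extChartAt I x x) :=
    (hasFDerivAt_id (𝕜 := ℝ) _).prodMk hud.hasFDerivAt
  have h1 := mfderiv_apply_eq_chart_self (hd.congr_of_eventuallyEq he).differentiableAt Y
  rw [he.fderiv_eq, mfderiv_comp x hch hsec, hd.fderiv] at h1
  exact h1

/-- The left-hand side of the equation of intermediate integrals without forces, in a chart. -/
theorem NondegenerateMetric.intermediate_lhs_eq [FiniteDimensional ℝ E]
    (g : NondegenerateMetric I M) {u : Π x : M, TangentSpace I x} (hu : SmoothVectorField I u)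
    (x : M) (Y : TangentSpace I x) :
    extDerivOneForm I (fun x' : M => g.toFun x' (u x')) x ![u x, Y]
      + differential I (fun x' : M => g.kineticEnergy (fieldSection I u x')) x Y =
    (g.inChart x (extChartAt I x x) (fderiv ℝ (vectorFieldInChart I u x) (extChartAt I x x)
        (vectorFieldInChart I u x (extChartAt I x x))) +
      g.christoffelForm x (extChartAt I x x, vectorFieldInChart I u x (extChartAt I x x)))
        (chartDeriv I x x Y) := by
  have hud := SmoothVectorField.differentiableAt_inChart hu x
  have hG := g.differentiableAt_inChart (mem_extChartAt_target (I := I) x)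
  have hform : oneFormInChart I (fun x' : M => g.toFun x' (u x')) x =ᶠ[𝓝 (extChartAt I x x)]
      fun y => g.inChart x y (vectorFieldInChart I u x y) := by
    filter_upwards [extChartAt_target_mem_nhds (I := I) x] with y hy
    refine ContinuousLinearMap.ext fun a => ?_
    rw [oneFormInChart_apply, g.inChart_apply, vectorFieldInChart, chartDerivSymm_chartDeriv hy]
  have hkin : (fun x' : M => g.kineticEnergy (fieldSection I u x')) ∘ (extChartAt I x).symm
      =ᶠ[𝓝 (extChartAt I x x)] fun y => (1 / 2) *
        g.inChart x y (vectorFieldInChart I u x y) (vectorFieldInChart I u x y) := by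
    filter_upwards [eventually_chart_symm_mem_source (I := I) x] with y hy
    have h := g.apply_eq_inChart hy.2 (u _) (u _)
    rw [(extChartAt I x).right_inv hy.1] at h
    exact congrArg ((1 / 2 : ℝ) * ·) h
  have hA := fderiv_apply_bilinear hG hud
  have hQ := fderiv_half_quadratic_comp hG hud (g.inChart_symm x _)
  have hd : differential I (fun x' : M => g.kineticEnergy (fieldSection I u x')) x Y = _ :=
    mfderiv_apply_eq_chart_self (hQ.1.congr_of_eventuallyEq hkin) Y
  -- With a the expression of `Y`, the term -G(Df(a), f) of the exterior derivative cancels G(f,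
  -- Df(a)) from the energy, as it does on `TM`.
  rw [hd, hkin.fderiv_eq, hQ.2, extDerivOneForm_apply, extDeriv_ofSubsingleton_apply
    (hA.1.congr_of_eventuallyEq hform), hform.fderiv_eq, hA.2, hA.2,
    chartDeriv_self_apply_eq, add_apply, add_apply, add_apply, g.christoffelForm_apply,
    g.inChart_symm x _ (fderiv ℝ _ _ (chartDeriv I x x Y))]
  ring

theorem NondegenerateMetric.isIntermediateIntegral_iff [FiniteDimensional ℝ E]
    (g : NondegenerateMetric I M)
    {D : Π v : TangentBundle I M, TangentSpace I.tangent v}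
    {α : Π v : TangentBundle I M, TangentSpace I.tangent v →L[ℝ] ℝ}
    (hD : IsSecondOrderEquation I D) (h : NewtonEquation g D α)
    {u : Π x : M, TangentSpace I x} (hu : SmoothVectorField I u) :
    IsIntermediateIntegral I D u ↔ IntermediateNewtonEquation g α u := by
  refine forall_congr' fun x => ?_
  have hsrc : x ∈ (chartAt H x).source := mem_chart_source H x
  have hpt : extChartAt I.tangent (fieldSection I u x) (fieldSection I u x) =
      (extChartAt I x x, vectorFieldInChart I u x (extChartAt I x x)) := by
    rw [extChartAt_tangent_apply (p := fieldSection I u x) (v := fieldSection I u x) hsrc, ← chartDeriv_self_apply_eq]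
    rfl
  have hsrc' : (fieldSection I u x).proj ∈ (chartAt H (fieldSection I u x).proj).source := hsrc
  have hDfst := (projTangentMap_eq_iff_of_mem_source hsrc' _).1 (hD.2 (fieldSection I u x))
  rw [hpt] at hDfst
  set b := (chartDeriv I.tangent (fieldSection I u x) (fieldSection I u x)
    (D (fieldSection I u x))).2 with hb
  have hα : ∀ Y : TangentSpace I x,
      α (fieldSection I u x) (fieldTangentMap I u x Y) =
        -(g.inChart x (extChartAt I x x) b + g.christoffelForm x
          (extChartAt I x x, vectorFieldInChart I u x (extChartAt I x x)))
            (chartDeriv I x x Y) := by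
    intro Y
    have h1 := h (fieldSection I u x) (fieldTangentMap I u x Y)
    rw [g.newton_lhs_eq hsrc' (hD.2 _), chartDeriv_fieldTangentMap hu, hpt] at h1
    exact eq_neg_of_add_eq_zero_right h1
  -- The base component of `D` is f, so the only vector of T_x M that u_* can send to `D` is `u x`;
  -- tangency reduces to the fibre components.
  have hL : D (fieldSection I u x) ∈ range (fieldTangentMap I u x) ↔
      fderiv ℝ (vectorFieldInChart I u x) (extChartAt I x x)
        (vectorFieldInChart I u x (extChartAt I x x)) = b := by
    constructor
    · rintro ⟨Y, hY⟩
      have h1 := chartDeriv_fieldTangentMap hu x Y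
      rw [hY] at h1
      rw [hb, h1]
      rw [h1] at hDfst
      simp only at hDfst ⊢
      rw [hDfst]
    · intro hb'
      refine ⟨u x, chartDeriv_injective_of_mem_source (I := I.tangent)
        (mem_chart_source (ModelProd H E) (fieldSection I u x)) ?_⟩
      rw [chartDeriv_fieldTangentMap hu, chartDeriv_self_apply_eq]
      exact Prod.ext hDfst.symm hb'
  -- Γ depends only on the point (y, f(y)), so it drops out when the Newton equation along the
  -- section is inserted.
  have hR : ∀ Y : TangentSpace I x,
      (extDerivOneForm I (fun x' : M => g.toFun x' (u x')) x ![u x, Y]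
        + differential I (fun x' : M => g.kineticEnergy (fieldSection I u x')) x Y
        + α (fieldSection I u x) (fieldTangentMap I u x Y) = 0) ↔
      g.inChart x (extChartAt I x x) (fderiv ℝ (vectorFieldInChart I u x) (extChartAt I x x)
        (vectorFieldInChart I u x (extChartAt I x x)) - b) (chartDeriv I x x Y) = 0 := by
    intro Y
    rw [g.intermediate_lhs_eq hu, hα, map_sub, sub_apply, add_apply, add_apply]
    ring_nf
  rw [hL, forall_congr' hR]
  constructor
  · intro h0 Y
    rw [h0, sub_self, map_zero, zero_apply]
  · intro h0
    rw [← sub_eq_zero]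
    refine g.inChart_nondegenerate (mem_extChartAt_target (I := I) x) _ fun c => ?_
    obtain ⟨Y, rfl⟩ := exists_chartDeriv_eq (I := I) hsrc c
    exact h0 Y

end IntermediateIntegral

end

end ClassicalMechanics

open ClassicalMechanics in
theorem mainTheorem4
    {E : Type*} [NormedAddCommGroup E] [NormedSpace ℝ E] [FiniteDimensional ℝ E]
    {M : Type*} [TopologicalSpace M] [ChartedSpace E M] [IsManifold 𝓘(ℝ, E) ∞ M]
    (g : NondegenerateMetric 𝓘(ℝ, E) M) :
    (∀ D : Π v : TangentBundle 𝓘(ℝ, E) M, TangentSpace 𝓘(ℝ, E).tangent v,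
      IsSecondOrderEquation 𝓘(ℝ, E) D →
        ∃! α : Π v : TangentBundle 𝓘(ℝ, E) M, TangentSpace 𝓘(ℝ, E).tangent v →L[ℝ] ℝ,
          IsHorizontalForm 𝓘(ℝ, E) α ∧ NewtonEquation g D α) ∧
    (∀ α : Π v : TangentBundle 𝓘(ℝ, E) M, TangentSpace 𝓘(ℝ, E).tangent v →L[ℝ] ℝ,
      IsHorizontalForm 𝓘(ℝ, E) α →
        ∃! D : Π v : TangentBundle 𝓘(ℝ, E) M, TangentSpace 𝓘(ℝ, E).tangent v,
          IsSecondOrderEquation 𝓘(ℝ, E) D ∧ NewtonEquation g D α) ∧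
    (∀ (D : Π v : TangentBundle 𝓘(ℝ, E) M, TangentSpace 𝓘(ℝ, E).tangent v)
      (α : Π v : TangentBundle 𝓘(ℝ, E) M, TangentSpace 𝓘(ℝ, E).tangent v →L[ℝ] ℝ),
      IsSecondOrderEquation 𝓘(ℝ, E) D → IsHorizontalForm 𝓘(ℝ, E) α → NewtonEquation g D α →
        ∀ u : Π x : M, TangentSpace 𝓘(ℝ, E) x, SmoothVectorField 𝓘(ℝ, E) u →
          (IsIntermediateIntegral 𝓘(ℝ, E) D u ↔ IntermediateNewtonEquation g α u)) :=
  ⟨fun _ hD => g.existsUnique_horizontalForm hD, fun _ hα => g.existsUnique_secondOrderEquation hα,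
    fun _ _ hD _ h _ hu => g.isIntermediateIntegral_iff hD h hu⟩
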